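/- \textbf{Setting.} There are $K$ arms and finitely many contexts $1,\dots,M$. In each trial $t=1,2,\dots$ a context $y_t$ and a vector of arm states $(x_{1,t},\dots,x_{K,t})$ with values in a set $\mathcal X$ are drawn; the pairs $(y_t,x_t)$ are i.i.d. over $t$, and $y_t$ is independent of $x_t$. Let $p_i=\Pr\{y_t=i\}>0$. Pulling arm $j$ in trial $t$ reveals $x_{j,t}$ and yields the reward $g(y_t,x_{j,t})$, where $g$ is a known bounded (measurable) function. Put $\theta_{i,j}=\mathbb E[g(i,x_{j,t})]$ and $G_i=\sup_{x\in\mathcal X}g(i,x)-\inf_{x\in\mathcal X}g(i,x)$. Assume that for each context $i$ the arm $h^*(i)=\arg\max_j\theta_{i,j}$ is unique, and let $\mathcal Y_j=\{i: h^*(i)=j\}$, $\Delta_j^{(i)}=\theta_{i,h^*(i)}-\theta_{i,j}$, $p_o=\min_i p_i$, $\Delta_o=\min_{i,j:\,h^*(i)\ne j}\Delta_j^{(i)}$. Let $R$ be any number with $G_i\le R$ for all $i$ (so $R=1$ is allowed if the rewards are normalized to ranges of length at most $1$). \textbf{Policy.} DCB($\varepsilon$) pulls arm $n$ in trial $n$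 for $n=1,\dots,K$. In each trial $n>K$, with context $y_n=i$, it pulls an arm $j$ that maximizes $$\hat\theta_{i,j}+G_i\sqrt{\frac{(2+\varepsilon)\ln n}{m_j}},$$ where $m_j$ is the number of earlier pulls of arm $j$ (for any context) and $\hat\theta_{i,j}$ is the average of $g(i,x_{j,s})$ over the earlier trials $s$ in which arm $j$ was pulled. Ties are broken arbitrarily, possibly at random, but independently of present and future arm states. \textbf{Theorem.} Let $\varepsilon>0$. There is a least positive integer $n_o$ with $$\Big\lfloor \frac{p_o n_o}{2K}\Big\rfloor>\Big\lceil\frac{4(2+\varepsilon)R^2\ln n_o}{\Delta_o^2}\Big\rceil ,$$ and for every arm $j$ that is optimal for some context (that is, $\mathcal Y_j\neq\emptyset$) and every $n$, the number $T_j^N(n)$ of trials among the first $n$ in which DCB($\varepsilon$) pulls arm $j$ for a context outside $\mathcal Y_j$ satisfies $$\mathbb E[T_j^N(n)]\le n_o+\sum_{i\in\mathcal Y_j}\frac{2}{p_i^2}+2^{3+2\varepsilon}K^{4+2\varepsilon}c_\varepsilon\sum_{i\in\mathcal Y_j}\frac1{p_i^{2+2\varepsilon}}+\frac{\pi^2}{3}\sum_{i\notin\mathcal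 Y_j}p_i,\qquad c_\varepsilon=\sum_{k=1}^\infty\frac1{k^{1+2\varepsilon}}.$$ (If $K=1$, the fraction with $\Delta_o$ is read as $0$.) -/

import Mathlib

open MeasureTheory ProbabilityTheory

noncomputable section

namespace ContextualBandit

variable {M K : ℕ} {Ω X 𝒰 : Type*}

/-! ### The stochastic environment

The `M` contexts are indexed by `Fin M`, the `K` arms by `Fin K`, and `X` is the set of all possible
states of an arm. `g i s` is the (known) reward obtained for context `i` from an arm in state `s`.
Time is counted from `0`: `y t` and `x t` are the context and the vector of arm states of
trial number `t + 1`. -/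

/-- The trials `(y t, x t)` are independent and identically distributed, and within a trial the
context is independent of the arm states. (The states of different arms in the same trial may
depend on each other.) -/
structure IsEnvironment [MeasurableSpace Ω] [MeasurableSpace X] (μ : Measure Ω)
    (y : ℕ → Ω → Fin M) (x : ℕ → Ω → Fin K → X) : Prop where
  measurable_context : ∀ t, Measurable (y t)
  measurable_state : ∀ t, Measurable (x t)
  indep : iIndepFun (fun t ω => (y t ω, x t ω)) μ
  identDistrib : ∀ t,
    IdentDistrib (fun ω => (y t ω, x t ω)) (fun ω => (y 0 ω, x 0 ω)) μ μ
  indep_context_state : ∀ t, IndepFun (y t) (x t) μ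

/-- The probability `p i` of context `i`. -/
def contextProb [MeasurableSpace Ω] (μ : Measure Ω) (y : ℕ → Ω → Fin M) (i : Fin M) : ℝ :=
  μ.real {ω | y 0 ω = i}

/-- The expected reward `θ i j = 𝔼[g(i, x_j)]` of arm `j` for context `i`. -/
def meanReward [MeasurableSpace Ω] (μ : Measure Ω) (g : Fin M → X → ℝ)
    (x : ℕ → Ω → Fin K → X) (i : Fin M) (j : Fin K) : ℝ :=
  ∫ ω, g i (x 0 ω j) ∂μ

/-- The range `G i = sup g(i, ·) - inf g(i, ·)` of the rewards for context `i`. -/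
def rewardRange (g : Fin M → X → ℝ) (i : Fin M) : ℝ :=
  (⨆ s, g i s) - ⨅ s, g i s

/-- `h` is the Bayes optimal hypothesis: `h i` is the (unique) arm that maximizes the expected
reward for context `i`. -/
def IsBayesOptimal (θ : Fin M → Fin K → ℝ) (h : Fin M → Fin K) : Prop :=
  ∀ i k, k ≠ h i → θ i k < θ i (h i)

/-- `p_o`, the minimum of the context probabilities. -/
def minProb (p : Fin M → ℝ) : ℝ := ⨅ i, p i

/-- `Δ_o`, the minimum of the gaps `θ i (h i) - θ i j` over all `i, j` with `h i ≠ j`. -/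
def minGap (θ : Fin M → Fin K → ℝ) (h : Fin M → Fin K) : ℝ :=
  ⨅ q : {q : Fin M × Fin K // h q.1 ≠ q.2}, (θ q.1.1 (h q.1.1) - θ q.1.1 q.1.2)

/-! ### The policy DCB(ε) -/

/-- The stored statistics: the reward averages `θ̂ i j` and the numbers of pulls `m j`. -/
structure Stats (M K : ℕ) where
  est : Fin M → Fin K → ℝ
  cnt : Fin K → ℕ

/-- The statistics before the first trial. -/
def Stats.zero : Stats M K := ⟨fun _ _ => 0, fun _ => 0⟩

/-- The update after arm `a` was pulled and its state was found to be `s`; the averages of *all*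
contexts are updated. -/
def Stats.update (g : Fin M → X → ℝ) (st : Stats M K) (a : Fin K) (s : X) : Stats M K where
  est i j := if j = a then (st.est i j * st.cnt j + g i s) / (st.cnt j + 1) else st.est i j
  cnt j := if j = a then st.cnt j + 1 else st.cnt j

/-- The statistics after `t` trials, when `A` is the sequence of pulled arms. -/
def stats (g : Fin M → X → ℝ) (x : ℕ → Ω → Fin K → X) (A : ℕ → Ω → Fin K) :
    ℕ → Ω → Stats M K
  | 0, _ => Stats.zero
  | t + 1, ω => (stats g x A t ω).update g (A t ω) (x t ω (A t ω))

/-- The upper confidence index of arm `j` for context `i` in trial number `n`. -/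
def ucbIndex (ε : ℝ) (g : Fin M → X → ℝ) (st : Stats M K) (n : ℕ) (i : Fin M) (j : Fin K) : ℝ :=
  st.est i j + rewardRange g i * Real.sqrt ((2 + ε) * Real.log n / st.cnt j)

/-- What may be known when the arm of trial number `t + 1` is chosen: the outcomes of the first `t`
trials, the present context, and the internal randomization `U`. -/
abbrev priorInfo [MeasurableSpace X] [MeasurableSpace 𝒰] (U : Ω → 𝒰) (y : ℕ → Ω → Fin M)
    (x : ℕ → Ω → Fin K → X) (t : ℕ) : MeasurableSpace Ω :=
  MeasurableSpace.comap U inferInstance ⊔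
    (⨆ s : Fin t, MeasurableSpace.comap (fun ω => (y s ω, x s ω)) inferInstance) ⊔
    MeasurableSpace.comap (y t) inferInstance

/-- `A` is the sequence of arms pulled by DCB(ε): `A t` is the arm of trial number `t + 1`. In the
first `K` trials every arm is pulled once, in order; then each trial pulls an arm whose index for
the present context is maximal. Ties are broken in an arbitrary, possibly randomized, way that does
not look at the present or future arm states. -/
structure IsDCB [MeasurableSpace X] [MeasurableSpace 𝒰] (ε : ℝ) (g : Fin M → X → ℝ)
    (U : Ω → 𝒰) (y : ℕ → Ω → Fin M) (x : ℕ → Ω → Fin K → X) (A : ℕ → Ω → Fin K) : Prop where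
  nonanticipating : ∀ t, Measurable[priorInfo U y x t] (A t)
  init : ∀ t (ht : t < K) ω, A t ω = ⟨t, ht⟩
  argmax : ∀ t, K ≤ t → ∀ ω k,
    ucbIndex ε g (stats g x A t ω) (t + 1) (y t ω) k ≤
      ucbIndex ε g (stats g x A t ω) (t + 1) (y t ω) (A t ω)

/-- `T_j^N(n)`: the number of trials among the first `n` in which arm `j` is pulled for a context
for which it is not optimal. -/
def nonOptimalPulls (h : Fin M → Fin K) (y : ℕ → Ω → Fin M) (A : ℕ → Ω → Fin K) (j : Fin K)
    (n : ℕ) (ω : Ω) : ℕ :=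
  ((Finset.range n).filter fun t => A t ω = j ∧ h (y t ω) ≠ j).card

end ContextualBandit

end

noncomputable section

namespace ContextualBandit

/-! Fix one context `i` for which arm `j` is optimal; the bound is proved with the terms of this `i`
alone and then enlarged to the sums. Trials with `t < n₀` are counted as one each. For `t ≥ n₀` put
`b = p i * t / (2 * K)`, which exceeds `c * log t` by at least 1, where `c = 4 (2 + ε) R² / Δ²`. An
arm with at least `c * log (t + 1)` pulls has confidence radius at most `Δ / 2`, so it can be chosen
wrongly only if its own estimate is too high or that of the optimal arm is too low
(`IsDCB.mem_deviationEvent`).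

Hence a wrong pull of `j` needs such a failure now, or fewer than `b` earlier pulls of `j`. In the
latter case either context `i` occurred fewer than `K * b = p i * t / 2` times, which Hoeffding's
inequality makes exponentially unlikely, or by pigeonhole another arm was pulled more than `b` times
for `i`. The last of those pulls was made by a well-explored suboptimal arm, so a confidence bound
failed in a trial whose number exceeds `b` (`IsDCB.stats_cnt_lt_subset`).

Failures are rare although the number of pulls is random: at a fixed parameter the exponential of
the error sum is a supermartingale, and a union over the values of the count gives probability at
most `(t + 1) ^ (-(3 + 2ε))` (`IsDCB.measureReal_deviationEvent_le`). A failure event depends on the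
past only, so it is independent of the present context, which supplies the factors `p i`. Summation
over `t` yields the three series. -/

/-! ### The threshold `n₀` and elementary series -/

theorem one_le_sub_of_ceil_lt_floor {u v : ℝ} (h : ⌈v⌉ < ⌊u⌋) : 1 ≤ u - v := by
  have h1 : ((⌈v⌉ + 1 : ℤ) : ℝ) ≤ ⌊u⌋ := by exact_mod_cast h
  have h2 := Int.le_ceil v
  have h3 := Int.floor_le u
  push_cast at h1
  linarith

/-- Once `a n - c log n` has reached `1`, it stays above `1`. -/
theorem one_le_linear_sub_log_of_le {a c : ℝ} (ha : a ≤ 1) (hc : 0 ≤ c) {m n : ℕ} (hm : 1 < m)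
    (h : 1 ≤ a * m - c * Real.log m) (hmn : m ≤ n) : 1 ≤ a * n - c * Real.log n := by
  rcases hmn.eq_or_lt with rfl | hlt
  · exact h
  have hm' : (1 : ℝ) < m := by exact_mod_cast hm
  have hlt' : (m : ℝ) < n := by exact_mod_cast hlt
  -- By concavity the chord of `log` over `[m, n]` is no steeper than over `[1, m]`. On `[1, m]` the
  -- slope times `c` is at most `a`, because the margin 1 in `h` is at least `a`.
  have key := strictConcaveOn_log_Ioi.concaveOn.slope_anti_adjacent (x := 1) (y := (m : ℝ))
    (z := (n : ℝ)) (by simp) (by simp; linarith) hm' hlt'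
  rw [Real.log_one, sub_zero, div_le_div_iff₀ (by linarith) (by linarith)] at key
  have h1 : c * Real.log m ≤ a * (m - 1) := by linarith
  have h2 : c * (Real.log n - Real.log m) * (m - 1) ≤ a * (n - m) * (m - 1) := by
    calc c * (Real.log n - Real.log m) * (m - 1)
        = c * ((Real.log n - Real.log m) * (m - 1)) := by ring
      _ ≤ c * (Real.log m * (n - m)) := mul_le_mul_of_nonneg_left key hc
      _ = (c * Real.log m) * (n - m) := by ring
      _ ≤ (a * (m - 1)) * (n - m) := mul_le_mul_of_nonneg_right h1 (by linarith)
      _ = _ := by ring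
  have h3 := le_of_mul_le_mul_right h2 (by linarith)
  linarith

theorem exists_ceil_log_lt_floor {a : ℝ} (ha : 0 < a) (c : ℝ) :
    ∃ n : ℕ, ⌈c * Real.log n⌉ < ⌊a * n⌋ := by
  have h1 : ∀ᶠ x : ℝ in Filter.atTop, ‖c * Real.log x‖ ≤ a / 2 * ‖x‖ :=
    (Real.isLittleO_log_id_atTop.const_mul_left c).bound (by positivity)
  have h2 := (tendsto_natCast_atTop_atTop (R := ℝ)).eventually h1
  -- With `a * n ≥ 4` the spare half `a * n / 2` is at least 2, which pays for both roundings.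
  have h3 := (tendsto_natCast_atTop_atTop (R := ℝ)).eventually_ge_atTop (4 / a)
  obtain ⟨n, hn1, hn2⟩ := (h2.and h3).exists
  refine ⟨n, ?_⟩
  rw [div_le_iff₀ ha] at hn2
  have h4 := Int.ceil_lt_add_one (c * Real.log n)
  have h5 := Int.sub_one_lt_floor (a * n)
  have h6 := (le_abs_self _).trans hn1
  rw [Real.norm_natCast] at h6
  have : ((⌈c * Real.log n⌉ : ℤ) : ℝ) < ⌊a * n⌋ := by nlinarith
  exact_mod_cast this

theorem sum_exp_neg_succ_mul_le {u : ℝ} (hu : 0 < u) (n : ℕ) :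
    ∑ t ∈ Finset.range n, Real.exp (-((t + 1 : ℕ) * u)) ≤ 1 / u := by
  -- The sharper bound is the integral of `exp (-s * u)` over `[0, n]`; it makes the induction close
  -- through `1 + u ≤ exp u`.
  have h : ∑ t ∈ Finset.range n, Real.exp (-((t + 1 : ℕ) * u)) ≤ (1 - Real.exp (-(n * u))) / u := by
    induction n with
    | zero => simp
    | succ n ih =>
      rw [Finset.sum_range_succ]
      have h1 : Real.exp (-(n * u)) = Real.exp (-((n + 1 : ℕ) * u)) * Real.exp u := by
        rw [← Real.exp_add]; congr 1; push_cast; ring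
      have h2 := Real.add_one_le_exp u
      have h3 := Real.exp_pos (-((n + 1 : ℕ) * u))
      rw [le_div_iff₀ hu] at ih ⊢
      rw [add_mul]
      nlinarith
  refine h.trans (div_le_div_of_nonneg_right ?_ hu.le)
  linarith [Real.exp_pos (-(n * u))]

theorem sum_succ_rpow_neg_le_zeta_two {q : ℝ} (hq : 2 ≤ q) (s : Finset ℕ) :
    ∑ t ∈ s, ((t + 1 : ℕ) : ℝ) ^ (-q) ≤ Real.pi ^ 2 / 6 := by
  have h := (hasSum_nat_add_iff' 1).mpr hasSum_zeta_two
  simp only [Finset.range_one, Finset.sum_singleton, Nat.cast_zero] at h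
  norm_num at h
  refine (Finset.sum_le_sum fun t _ => ?_).trans
    (sum_le_hasSum s (fun t _ => by positivity) h)
  have h1 : (1 : ℝ) ≤ ((t + 1 : ℕ) : ℝ) := by push_cast; linarith [Nat.cast_nonneg (α := ℝ) t]
  calc ((t + 1 : ℕ) : ℝ) ^ (-q) ≤ ((t + 1 : ℕ) : ℝ) ^ (-2 : ℝ) :=
        Real.rpow_le_rpow_of_exponent_le h1 (by linarith)
    _ = _ := by
        rw [Real.rpow_neg (by positivity)]
        norm_cast

theorem sum_succ_rpow_neg_le_tsum {q r : ℝ} (hr : 1 < r) (hq : r ≤ q) (s : Finset ℕ) :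
    ∑ t ∈ s, ((t + 1 : ℕ) : ℝ) ^ (-q) ≤ ∑' k : ℕ, 1 / ((k : ℝ) + 1) ^ r := by
  have hs : Summable fun k : ℕ => 1 / ((k : ℝ) + 1) ^ r := by
    exact_mod_cast (summable_nat_add_iff 1).mpr (Real.summable_one_div_nat_rpow.mpr hr)
  refine (Finset.sum_le_sum fun t _ => ?_).trans (hs.sum_le_tsum s fun t _ => by positivity)
  have h1 : (1 : ℝ) ≤ ((t + 1 : ℕ) : ℝ) := by push_cast; linarith [Nat.cast_nonneg (α := ℝ) t]
  calc ((t + 1 : ℕ) : ℝ) ^ (-q) ≤ ((t + 1 : ℕ) : ℝ) ^ (-r) :=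
        Real.rpow_le_rpow_of_exponent_le h1 (by linarith)
    _ = _ := by
        rw [Real.rpow_neg (by positivity), one_div]
        push_cast; rfl

/-! ### Independence -/

/-- On the π-system of intersections `a ∩ b` the probability factors in two stages: split off `a`
first, then separate `b` from `c`. It serves to adjoin the randomization to the past, and then the
present context to the history. -/
theorem indep_sup_left_of_indep {Ω : Type*} {m₁ m₂ m₃ mΩ : MeasurableSpace Ω} {μ : Measure Ω}
    [IsProbabilityMeasure μ] (h₁ : m₁ ≤ mΩ) (h₂ : m₂ ≤ mΩ) (h₃ : m₃ ≤ mΩ)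
    (h : Indep m₁ (m₂ ⊔ m₃) μ) (h' : Indep m₂ m₃ μ) : Indep (m₁ ⊔ m₂) m₃ μ := by
  let π : Set (Set Ω) := {s | ∃ a b, MeasurableSet[m₁] a ∧ MeasurableSet[m₂] b ∧ a ∩ b = s}
  have hπ : IsPiSystem π := by
    rintro _ ⟨a, b, ha, hb, rfl⟩ _ ⟨c, d, hc, hd, rfl⟩ _
    exact ⟨a ∩ c, b ∩ d, ha.inter hc, hb.inter hd, by ext; simp; tauto⟩
  have hgen : m₁ ⊔ m₂ = MeasurableSpace.generateFrom π := by
    apply le_antisymm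
    · refine sup_le (fun a ha => ?_) (fun b hb => ?_)
      · exact MeasurableSpace.measurableSet_generateFrom ⟨a, Set.univ, ha, .univ, by simp⟩
      · exact MeasurableSpace.measurableSet_generateFrom ⟨Set.univ, b, .univ, hb, by simp⟩
    · refine MeasurableSpace.generateFrom_le ?_
      rintro _ ⟨a, b, ha, hb, rfl⟩
      exact MeasurableSet.inter ((le_sup_left : m₁ ≤ m₁ ⊔ m₂) _ ha)
        ((le_sup_right : m₂ ≤ m₁ ⊔ m₂) _ hb)
  refine IndepSets.indep (sup_le h₁ h₂) h₃ hπ (@MeasurableSpace.isPiSystem_measurableSet _ m₃) hgen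
    (@MeasurableSpace.generateFrom_measurableSet _ m₃).symm ?_
  rw [IndepSets_iff]
  rintro _ c ⟨a, b, ha, hb, rfl⟩ hc
  rw [Indep_iff] at h h'
  have hb' : MeasurableSet[m₂ ⊔ m₃] b := (le_sup_left : m₂ ≤ m₂ ⊔ m₃) _ hb
  have hc' : MeasurableSet[m₂ ⊔ m₃] c := (le_sup_right : m₃ ≤ m₂ ⊔ m₃) _ hc
  rw [Set.inter_assoc, h a _ ha (hb'.inter hc'), h' b c hb hc, h a b ha hb', mul_assoc]

variable {M K : ℕ} {Ω X 𝒰 : Type*}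

/-- The information carried by the internal randomization and the first `t` trials. -/
abbrev history [MeasurableSpace X] [MeasurableSpace 𝒰] (U : Ω → 𝒰) (y : ℕ → Ω → Fin M)
    (x : ℕ → Ω → Fin K → X) (t : ℕ) : MeasurableSpace Ω :=
  MeasurableSpace.comap U inferInstance ⊔
    (⨆ s : Fin t, MeasurableSpace.comap (fun ω => (y s ω, x s ω)) inferInstance)

section Environment

variable [MeasurableSpace X] [MeasurableSpace 𝒰] {U : Ω → 𝒰} {y : ℕ → Ω → Fin M}
  {x : ℕ → Ω → Fin K → X}

theorem trial_le_history {s t : ℕ} (hst : s < t) :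
    MeasurableSpace.comap (fun ω => (y s ω, x s ω)) inferInstance ≤ history U y x t :=
  le_sup_of_le_right (le_iSup (fun s : Fin t =>
    MeasurableSpace.comap (fun ω => (y s ω, x s ω)) inferInstance) ⟨s, hst⟩)

theorem history_le_history {s t : ℕ} (hst : s ≤ t) : history U y x s ≤ history U y x t :=
  sup_le le_sup_left (iSup_le fun r => trial_le_history (r.2.trans_le hst))

theorem context_le_trial (t : ℕ) : MeasurableSpace.comap (y t) inferInstance ≤
    MeasurableSpace.comap (fun ω => (y t ω, x t ω)) inferInstance :=
  (measurable_fst.comp (comap_measurable fun ω => (y t ω, x t ω))).comap_le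

theorem state_le_trial (t : ℕ) : MeasurableSpace.comap (x t) inferInstance ≤
    MeasurableSpace.comap (fun ω => (y t ω, x t ω)) inferInstance :=
  (measurable_snd.comp (comap_measurable fun ω => (y t ω, x t ω))).comap_le

theorem priorInfo_le_history {s t : ℕ} (hst : s < t) : priorInfo U y x s ≤ history U y x t :=
  sup_le (history_le_history hst.le) ((context_le_trial s).trans (trial_le_history hst))

variable [mΩ : MeasurableSpace Ω] {μ : Measure Ω}

theorem IsEnvironment.measurable_trial (henv : IsEnvironment μ y x) (t : ℕ) :
    Measurable fun ω => (y t ω, x t ω) :=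
  (henv.measurable_context t).prodMk (henv.measurable_state t)

theorem IsEnvironment.history_le (henv : IsEnvironment μ y x) (hU : Measurable U) (t : ℕ) :
    history U y x t ≤ mΩ :=
  sup_le hU.comap_le (iSup_le fun s => (henv.measurable_trial s).comap_le)

theorem IsEnvironment.priorInfo_le (henv : IsEnvironment μ y x) (hU : Measurable U) (t : ℕ) :
    priorInfo U y x t ≤ mΩ :=
  sup_le (henv.history_le hU t) (henv.measurable_context t).comap_le

theorem IsEnvironment.indep_history_trial [IsProbabilityMeasure μ] (henv : IsEnvironment μ y x)
    (hU : Measurable U) (hU_indep : IndepFun U (fun ω t => (y t ω, x t ω)) μ) (t : ℕ) :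
    Indep (history U y x t)
      (MeasurableSpace.comap (fun ω => (y t ω, x t ω)) inferInstance) μ := by
  have hpast : (⨆ s : Fin t, MeasurableSpace.comap (fun ω => (y s ω, x s ω)) inferInstance) ≤ mΩ :=
    iSup_le fun s => (henv.measurable_trial s).comap_le
  have hle : ∀ s, MeasurableSpace.comap (fun ω => (y s ω, x s ω)) inferInstance ≤
      MeasurableSpace.comap (fun ω t => (y t ω, x t ω)) inferInstance := fun s =>
    ((measurable_pi_apply s).comp (comap_measurable fun ω t => (y t ω, x t ω))).comap_le
  refine indep_sup_left_of_indep hU.comap_le hpast (henv.measurable_trial t).comap_le ?_ ?_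
  · exact indep_of_indep_of_le_right hU_indep (sup_le (iSup_le fun s => hle s) (hle t))
  · have h := indep_iSup_of_disjoint (fun s => (henv.measurable_trial s).comap_le) henv.indep
      (S := {s | s < t}) (T := {t}) (by simp)
    refine indep_of_indep_of_le_right (indep_of_indep_of_le_left h ?_) ?_
    · exact iSup_le fun s => le_iSup₂_of_le (s : ℕ) s.2 le_rfl
    · simp

/-- Here the independence of context and state within a trial enters: knowing `y t` when the arm is
chosen must not bias the observed state. -/
theorem IsEnvironment.indep_priorInfo_state [IsProbabilityMeasure μ] (henv : IsEnvironment μ y x)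
    (hU : Measurable U) (hU_indep : IndepFun U (fun ω t => (y t ω, x t ω)) μ) (t : ℕ) :
    Indep (priorInfo U y x t) (MeasurableSpace.comap (x t) inferInstance) μ :=
  indep_sup_left_of_indep (henv.history_le hU t) (henv.measurable_context t).comap_le
    (henv.measurable_state t).comap_le
    (indep_of_indep_of_le_right (henv.indep_history_trial hU hU_indep t)
      (sup_le (context_le_trial t) (state_le_trial t)))
    (henv.indep_context_state t)

theorem IsEnvironment.measureReal_context [IsProbabilityMeasure μ] (henv : IsEnvironment μ y x)
    (t : ℕ) (i : Fin M) : μ.real {ω | y t ω = i} = contextProb μ y i := by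
  have h := (henv.identDistrib t).comp measurable_fst
  exact congrArg ENNReal.toReal (h.measure_mem_eq (s := {i}) (MeasurableSet.singleton i))

/-- The present context is independent of the past. -/
theorem IsEnvironment.measureReal_context_inter [IsProbabilityMeasure μ]
    (henv : IsEnvironment μ y x) (hU : Measurable U)
    (hU_indep : IndepFun U (fun ω t => (y t ω, x t ω)) μ) (t : ℕ) (i : Fin M) {D : Set Ω}
    (hD : MeasurableSet[history U y x t] D) :
    μ.real ({ω | y t ω = i} ∩ D) = contextProb μ y i * μ.real D := by
  have h := (Indep_iff _ _ μ).1 (henv.indep_history_trial hU hU_indep t) D {ω | y t ω = i} hD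
    (context_le_trial t _ ⟨{i}, MeasurableSet.singleton i, rfl⟩)
  rw [Set.inter_comm, measureReal_def, h, ENNReal.toReal_mul, mul_comm,
    ← henv.measureReal_context t i]
  rfl

theorem IsEnvironment.identDistrib_state [IsProbabilityMeasure μ] (henv : IsEnvironment μ y x)
    (t : ℕ) : IdentDistrib (x t) (x 0) μ μ :=
  (henv.identDistrib t).comp measurable_snd

end Environment

/-! ### Stored statistics -/

section Stats

variable {g : Fin M → X → ℝ} {x : ℕ → Ω → Fin K → X} {A : ℕ → Ω → Fin K}

theorem stats_cnt_succ (t : ℕ) (ω : Ω) (k : Fin K) :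
    (stats g x A (t + 1) ω).cnt k = (stats g x A t ω).cnt k + if A t ω = k then 1 else 0 := by
  simp only [stats, Stats.update, eq_comm (a := k)]
  split_ifs <;> simp

theorem stats_cnt_eq_card (t : ℕ) (ω : Ω) (k : Fin K) :
    (stats g x A t ω).cnt k = ((Finset.range t).filter fun s => A s ω = k).card := by
  induction t with
  | zero => simp [stats, Stats.zero]
  | succ t ih =>
    rw [stats_cnt_succ, ih, Finset.range_add_one, Finset.filter_insert]
    split_ifs <;> simp

theorem stats_cnt_le (t : ℕ) (ω : Ω) (k : Fin K) : (stats g x A t ω).cnt k ≤ t := by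
  rw [stats_cnt_eq_card]
  exact (Finset.card_filter_le _ _).trans (by simp)

/-- The product of average and count is the sum of the observed rewards, which is additive; the
arbitrary initial average is harmless because it is multiplied by 0. -/
theorem stats_est_mul_cnt_succ (t : ℕ) (ω : Ω) (i : Fin M) (k : Fin K) :
    (stats g x A (t + 1) ω).est i k * (stats g x A (t + 1) ω).cnt k =
      (stats g x A t ω).est i k * (stats g x A t ω).cnt k +
        if A t ω = k then g i (x t ω k) else 0 := by
  simp only [stats, Stats.update, eq_comm (a := k)]
  split_ifs with h
  · subst h
    push_cast
    field_simp
  · simp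

/-- The σ-algebra on `Ω` is left free and only trials before `t` are assumed measurable, so that the
lemma applies to `history` and `priorInfo` as well as to the ambient σ-algebra. -/
theorem measurable_stats [MeasurableSpace Ω] [MeasurableSpace X] (hg : ∀ i, Measurable (g i))
    {t : ℕ} (hA : ∀ s < t, Measurable (A s)) (hx : ∀ s < t, Measurable (x s)) :
    (∀ i k, Measurable fun ω => (stats g x A t ω).est i k) ∧
      ∀ k, Measurable fun ω => (stats g x A t ω).cnt k := by
  induction t with
  | zero => exact ⟨fun i k => measurable_const, fun k => measurable_const⟩
  | succ t ih =>
    obtain ⟨h1, h2⟩ := ih (fun s hs => hA s (hs.trans t.lt_succ_self))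
      (fun s hs => hx s (hs.trans t.lt_succ_self))
    have hAt := hA t t.lt_succ_self
    have hset : ∀ k, MeasurableSet {ω | k = A t ω} := fun k => by
      have h : MeasurableSet {ω | A t ω = k} := hAt (MeasurableSet.singleton k)
      simpa only [eq_comm] using h
    have h2' : ∀ k, Measurable fun ω => ((stats g x A t ω).cnt k : ℝ) := fun k =>
      (measurable_from_top (f := (Nat.cast : ℕ → ℝ))).comp (h2 k)
    refine ⟨fun i k => ?_, fun k => ?_⟩
    · have hfun : (fun ω => (stats g x A (t + 1) ω).est i k) = fun ω =>
          if k = A t ω then ((stats g x A t ω).est i k * (stats g x A t ω).cnt k + g i (x t ω k)) /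
            ((stats g x A t ω).cnt k + 1) else (stats g x A t ω).est i k := by
        funext ω
        simp only [stats, Stats.update]
        split_ifs with h
        · rw [← h]
        · rfl
      rw [hfun]
      refine Measurable.ite (hset k) ?_ (h1 i k)
      exact (((h1 i k).mul (h2' k)).add ((hg i).comp
        ((measurable_pi_apply k).comp (hx t t.lt_succ_self)))).div ((h2' k).add_const 1)
    · exact Measurable.ite (hset k) ((h2 k).add_const 1) (h2 k)

end Stats

/-- The confidence radius of arm `k` for context `i` in trial number `t + 1`. -/
def bonus (ε : ℝ) (g : Fin M → X → ℝ) (x : ℕ → Ω → Fin K → X) (A : ℕ → Ω → Fin K) (i : Fin M)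
    (k : Fin K) (t : ℕ) (ω : Ω) : ℝ :=
  rewardRange g i * Real.sqrt ((2 + ε) * Real.log (t + 1 : ℕ) / (stats g x A t ω).cnt k)

/-- The event that the estimate for context `i` and arm `k` deviates from `θ i k` by at least the
confidence radius, upwards for `σ = 1` and downwards for `σ = -1`. -/
def deviationEvent (ε : ℝ) (g : Fin M → X → ℝ) (x : ℕ → Ω → Fin K → X) (A : ℕ → Ω → Fin K)
    (θ : Fin M → Fin K → ℝ) (σ : ℝ) (i : Fin M) (k : Fin K) (t : ℕ) : Set Ω :=
  {ω | 0 < (stats g x A t ω).cnt k ∧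
    bonus ε g x A i k t ω ≤ σ * ((stats g x A t ω).est i k - θ i k)}

theorem measurableSet_deviationEvent [MeasurableSpace Ω] [MeasurableSpace X] {ε : ℝ}
    {g : Fin M → X → ℝ} {x : ℕ → Ω → Fin K → X} {A : ℕ → Ω → Fin K}
    (hg : ∀ i, Measurable (g i)) {t : ℕ} (hA : ∀ s < t, Measurable (A s))
    (hx : ∀ s < t, Measurable (x s)) (θ : Fin M → Fin K → ℝ) (σ : ℝ) (i : Fin M) (k : Fin K) :
    MeasurableSet (deviationEvent ε g x A θ σ i k t) := by
  obtain ⟨h1, h2⟩ := measurable_stats hg hA hx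
  have h2' : Measurable fun ω => ((stats g x A t ω).cnt k : ℝ) :=
    (measurable_from_top (f := (Nat.cast : ℕ → ℝ))).comp (h2 k)
  rw [deviationEvent, Set.ofPred_and]
  refine (measurableSet_lt measurable_const (h2 k)).inter (measurableSet_le ?_ ?_)
  · exact (Real.continuous_sqrt.measurable.comp (h2'.const_div _)).const_mul _
  · exact ((h1 i k).sub_const _).const_mul _

/-! ### Concentration -/

section Concentration

variable [MeasurableSpace X] [MeasurableSpace 𝒰] {U : Ω → 𝒰} {y : ℕ → Ω → Fin M}
  {x : ℕ → Ω → Fin K → X} {g : Fin M → X → ℝ} {A : ℕ → Ω → Fin K} {ε : ℝ}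

theorem IsDCB.measurable_history (hA : IsDCB ε g U y x A) {s t : ℕ} (hst : s < t) :
    Measurable[history U y x t] (A s) :=
  (hA.nonanticipating s).mono (priorInfo_le_history hst) le_rfl

theorem measurable_state_history {s t : ℕ} (hst : s < t) : Measurable[history U y x t] (x s) :=
  (comap_measurable (x s)).mono ((state_le_trial s).trans (trial_le_history hst)) le_rfl

/-- The failure in trial `t + 1` is decided by the first `t` trials. This makes it independent of `y
t`. -/
theorem IsDCB.measurableSet_deviationEvent (hA : IsDCB ε g U y x A) (hg : ∀ i, Measurable (g i))
    (θ : Fin M → Fin K → ℝ) (σ : ℝ) (i : Fin M) (k : Fin K) (t : ℕ) :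
    MeasurableSet[history U y x t] (deviationEvent ε g x A θ σ i k t) :=
  @ContextualBandit.measurableSet_deviationEvent _ _ _ _ (history U y x t) _ _ _ _ _ hg _
    (fun _ hs => hA.measurable_history hs) (fun _ hs => measurable_state_history hs) θ σ i k

variable [mΩ : MeasurableSpace Ω] {μ : Measure Ω}

theorem IsDCB.measurable (hA : IsDCB ε g U y x A) (henv : IsEnvironment μ y x)
    (hU : Measurable U) (t : ℕ) : Measurable (A t) :=
  (hA.nonanticipating t).mono (henv.priorInfo_le hU t) le_rfl

variable [IsProbabilityMeasure μ]

/-- Hoeffding's lemma for the rewards. -/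
theorem IsEnvironment.lintegral_exp_reward_le (henv : IsEnvironment μ y x)
    (hg : ∀ i, Measurable (g i)) (hgB : ∃ B : ℝ, ∀ i s, |g i s| ≤ B) (lam : ℝ) (i : Fin M)
    (k : Fin K) (t : ℕ) :
    ∫⁻ ω, ENNReal.ofReal (Real.exp (lam * (g i (x t ω k) - meanReward μ g x i k) -
      lam ^ 2 * rewardRange g i ^ 2 / 8)) ∂μ ≤ 1 := by
  obtain ⟨B, hB⟩ := hgB
  have hmeas : Measurable fun ω => g i (x t ω k) :=
    (hg i).comp ((measurable_pi_apply k).comp (henv.measurable_state t))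
  have hmem : ∀ ω, g i (x t ω k) ∈ Set.Icc (⨅ s, g i s) (⨆ s, g i s) := fun ω =>
    ⟨ciInf_le ⟨-B, by rintro _ ⟨s, rfl⟩; exact (abs_le.1 (hB i s)).1⟩ _,
      le_ciSup (f := g i) ⟨B, by rintro _ ⟨s, rfl⟩; exact (abs_le.1 (hB i s)).2⟩ _⟩
  have hsub := hasSubgaussianMGF_of_mem_Icc (μ := μ) hmeas.aemeasurable (ae_of_all _ hmem)
  have hmean : ∫ ω, g i (x t ω k) ∂μ = meanReward μ g x i k :=
    ((henv.identDistrib_state t).comp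
      ((hg i).comp (measurable_pi_apply k))).integral_eq
  rw [hmean] at hsub
  have hmgf := hsub.mgf_le lam
  have hint := hsub.integrable_exp_mul lam
  have hsplit : ∀ ω, ENNReal.ofReal (Real.exp (lam * (g i (x t ω k) - meanReward μ g x i k) -
      lam ^ 2 * rewardRange g i ^ 2 / 8)) =
      ENNReal.ofReal (Real.exp (lam * (g i (x t ω k) - meanReward μ g x i k)) *
        Real.exp (-(lam ^ 2 * rewardRange g i ^ 2 / 8))) := fun ω => by
    rw [sub_eq_add_neg, Real.exp_add]
  simp_rw [hsplit]
  rw [← ofReal_integral_eq_lintegral_ofReal (hint.mul_const _)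
    (ae_of_all _ fun ω => by positivity), integral_mul_const]
  refine ENNReal.ofReal_le_one.2 ?_
  rw [mgf] at hmgf
  refine (mul_le_mul_of_nonneg_right hmgf (Real.exp_pos _).le).trans ?_
  rw [← Real.exp_add, ← Real.exp_zero, Real.exp_le_exp]
  refine le_of_eq ?_
  have hr : |(⨆ s, g i s) - ⨅ s, g i s| ^ 2 = rewardRange g i ^ 2 := by
    rw [sq_abs, rewardRange]
  push_cast
  rw [Real.norm_eq_abs, div_pow, hr]
  ring

/-- The exponential supermartingale of the estimation error. -/
theorem IsDCB.lintegral_exp_error_le (hA : IsDCB ε g U y x A) (henv : IsEnvironment μ y x)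
    (hU : Measurable U) (hU_indep : IndepFun U (fun ω t => (y t ω, x t ω)) μ)
    (hg : ∀ i, Measurable (g i)) (hgB : ∃ B : ℝ, ∀ i s, |g i s| ≤ B) (lam : ℝ) (i : Fin M)
    (k : Fin K) (t : ℕ) :
    ∫⁻ ω, ENNReal.ofReal (Real.exp (lam * ((stats g x A t ω).est i k * (stats g x A t ω).cnt k -
      meanReward μ g x i k * (stats g x A t ω).cnt k) -
        lam ^ 2 * rewardRange g i ^ 2 / 8 * (stats g x A t ω).cnt k)) ∂μ ≤ 1 := by
  induction t with
  | zero => simp [stats, Stats.zero]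
  | succ t ih =>
    set W : Ω → ENNReal := fun ω => ENNReal.ofReal (Real.exp (lam *
      ((stats g x A t ω).est i k * (stats g x A t ω).cnt k -
        meanReward μ g x i k * (stats g x A t ω).cnt k) -
        lam ^ 2 * rewardRange g i ^ 2 / 8 * (stats g x A t ω).cnt k)) with hW
    set V : Ω → ENNReal := fun ω => ENNReal.ofReal (Real.exp (lam *
      (g i (x t ω k) - meanReward μ g x i k) - lam ^ 2 * rewardRange g i ^ 2 / 8)) with hV
    have hle := henv.priorInfo_le hU t
    have hWp : Measurable[priorInfo U y x t] W := by
      obtain ⟨h1, h2⟩ := @measurable_stats _ _ _ _ g x A (priorInfo U y x t) _ hg t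
        (fun s hs => (hA.measurable_history hs).mono le_sup_left le_rfl)
        (fun s hs => (measurable_state_history hs).mono le_sup_left le_rfl)
      have h2' : Measurable[priorInfo U y x t] fun ω => ((stats g x A t ω).cnt k : ℝ) :=
        (measurable_from_top (f := (Nat.cast : ℕ → ℝ))).comp (h2 k)
      exact ENNReal.measurable_ofReal.comp (Real.measurable_exp.comp
        (((((h1 i k).mul h2').sub (h2'.const_mul _)).const_mul _).sub (h2'.const_mul _)))
    have hSp : MeasurableSet[priorInfo U y x t] {ω | A t ω = k} :=
      hA.nonanticipating t (MeasurableSet.singleton k)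
    have hS : MeasurableSet {ω | A t ω = k} := hle _ hSp
    have hVp : Measurable[MeasurableSpace.comap (x t) inferInstance] V := by
      have h3 : Measurable[MeasurableSpace.comap (x t) inferInstance] fun ω => g i (x t ω k) :=
        (hg i).comp ((measurable_pi_apply k).comp (comap_measurable (x t)))
      exact ENNReal.measurable_ofReal.comp (Real.measurable_exp.comp
        (((h3.sub_const _).const_mul _).sub_const _))
    -- The new factor `V` appears only where arm `k` is pulled. That decision and `W` are prior
    -- information, hence independent of `V`, whose mean is at most 1.
    have hstep : ∀ ω, ENNReal.ofReal (Real.exp (lam *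
        ((stats g x A (t + 1) ω).est i k * (stats g x A (t + 1) ω).cnt k -
          meanReward μ g x i k * (stats g x A (t + 1) ω).cnt k) -
          lam ^ 2 * rewardRange g i ^ 2 / 8 * (stats g x A (t + 1) ω).cnt k)) =
        {ω | A t ω = k}ᶜ.indicator W ω + {ω | A t ω = k}.indicator W ω * V ω := fun ω => by
      rw [stats_est_mul_cnt_succ, stats_cnt_succ]
      by_cases h : A t ω = k
      · rw [Set.indicator_of_notMem (by simpa using h), Set.indicator_of_mem (by simpa using h),
          zero_add, hW, hV, ← ENNReal.ofReal_mul (Real.exp_pos _).le, ← Real.exp_add]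
        simp only [h, if_true]
        push_cast
        ring_nf
      · rw [Set.indicator_of_mem (by simpa using h), Set.indicator_of_notMem (by simpa using h)]
        simp [h, hW]
    simp_rw [hstep]
    rw [lintegral_add_left ((hWp.mono hle le_rfl).indicator hS.compl),
      lintegral_mul_eq_lintegral_mul_lintegral_of_independent_measurableSpace hle
        (henv.measurable_state t).comap_le (henv.indep_priorInfo_state hU hU_indep t)
        (hWp.indicator hSp) hVp]
    calc _ ≤ ∫⁻ ω, {ω | A t ω = k}ᶜ.indicator W ω ∂μ + ∫⁻ ω, {ω | A t ω = k}.indicator W ω ∂μ := by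
          gcongr
          exact mul_le_of_le_one_right' (henv.lintegral_exp_reward_le hg hgB lam i k t)
      _ = ∫⁻ ω, W ω ∂μ := by
          rw [lintegral_indicator hS.compl, lintegral_indicator hS, add_comm,
            lintegral_add_compl _ hS]
      _ ≤ 1 := ih

/-- Each confidence bound fails in trial number `t + 1` with probability at most
`(t + 1) ^ (-(3 + 2ε))`. -/
theorem IsDCB.measureReal_deviationEvent_le (hA : IsDCB ε g U y x A)
    (henv : IsEnvironment μ y x) (hU : Measurable U)
    (hU_indep : IndepFun U (fun ω t => (y t ω, x t ω)) μ)
    (hg : ∀ i, Measurable (g i)) (hgB : ∃ B : ℝ, ∀ i s, |g i s| ≤ B) (hε : 0 ≤ ε) {i : Fin M}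
    (hG : 0 < rewardRange g i) {σ : ℝ} (hσ : σ ^ 2 = 1) (k : Fin K) (t : ℕ) :
    μ.real (deviationEvent ε g x A (meanReward μ g x) σ i k t) ≤
      ((t + 1 : ℕ) : ℝ) ^ (-(3 + 2 * ε)) := by
  have hlog : 0 ≤ Real.log (t + 1 : ℕ) := Real.log_natCast_nonneg _
  have hn : (0 : ℝ) < ((t + 1 : ℕ) : ℝ) := by positivity
  set D := deviationEvent ε g x A (meanReward μ g x) σ i k t with hD
  -- The number of pulls is random, so the event is cut according to its value `m`; each piece is
  -- treated with a parameter tuned to that `m`.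
  have hcover : D ⊆ ⋃ m ∈ Finset.Icc 1 t, D ∩ {ω | (stats g x A t ω).cnt k = m} := fun ω hω => by
    simp only [Set.mem_iUnion, Finset.mem_Icc]
    exact ⟨_, ⟨hω.1, stats_cnt_le t ω k⟩, hω, rfl⟩
  have hpiece : ∀ m ∈ Finset.Icc 1 t, μ.real (D ∩ {ω | (stats g x A t ω).cnt k = m}) ≤
      ((t + 1 : ℕ) : ℝ) ^ (-(4 + 2 * ε)) := fun m hm => by
    have hm0 : (0 : ℝ) < m := by exact_mod_cast (Finset.mem_Icc.1 hm).1
    set c := Real.sqrt ((2 + ε) * Real.log (t + 1 : ℕ) / m) with hc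
    have hc2 : c ^ 2 * m = (2 + ε) * Real.log (t + 1 : ℕ) := by
      rw [hc, Real.sq_sqrt (by positivity)]
      field_simp
    set G := rewardRange g i with hGdef
    -- This value maximizes `lam * G * c * m - lam ^ 2 * G ^ 2 * m / 8` for `σ = 1`; the maximum `2
    -- * c ^ 2 * m = (4 + 2ε) * log (t + 1)` gives the exponent.
    set lam := σ * (4 * c / G) with hlam
    set W : Ω → ENNReal := fun ω => ENNReal.ofReal (Real.exp (lam *
      ((stats g x A t ω).est i k * (stats g x A t ω).cnt k -
        meanReward μ g x i k * (stats g x A t ω).cnt k) -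
        lam ^ 2 * G ^ 2 / 8 * (stats g x A t ω).cnt k)) with hW
    have hlam2 : lam ^ 2 * G ^ 2 / 8 * m = 2 * (c ^ 2 * m) := by
      rw [hlam, mul_pow, hσ]
      field_simp
      ring
    have hsub : D ∩ {ω | (stats g x A t ω).cnt k = m} ⊆
        {ω | ENNReal.ofReal (Real.exp (2 * (c ^ 2 * m))) ≤ W ω} := by
      rintro ω ⟨⟨-, hω⟩, hcnt⟩
      rw [Set.mem_ofPred_eq] at hcnt
      rw [bonus, hcnt, ← hc] at hω
      simp only [Set.mem_ofPred_eq, hW, hcnt]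
      refine ENNReal.ofReal_le_ofReal (Real.exp_le_exp.2 ?_)
      rw [hlam2]
      have h1 : lam * ((stats g x A t ω).est i k * m - meanReward μ g x i k * m) =
          4 * c / G * m * (σ * ((stats g x A t ω).est i k - meanReward μ g x i k)) := by
        rw [hlam]; ring
      have h2 : 4 * c / G * m * (G * c) = 4 * (c ^ 2 * m) := by
        field_simp
      have h3 : 4 * c / G * m * (G * c) ≤
          4 * c / G * m * (σ * ((stats g x A t ω).est i k - meanReward μ g x i k)) :=
        mul_le_mul_of_nonneg_left hω (by positivity)
      linarith
    have hWmeas : AEMeasurable W μ := by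
      obtain ⟨h1, h2⟩ := measurable_stats (t := t) hg (fun s _ => hA.measurable henv hU s)
        (fun s _ => henv.measurable_state s)
      have h2' : Measurable fun ω => ((stats g x A t ω).cnt k : ℝ) :=
        (measurable_from_top (f := (Nat.cast : ℕ → ℝ))).comp (h2 k)
      exact (ENNReal.measurable_ofReal.comp (Real.measurable_exp.comp
        (((((h1 i k).mul h2').sub (h2'.const_mul _)).const_mul _).sub
          (h2'.const_mul _)))).aemeasurable
    have hpos : ENNReal.ofReal (Real.exp (2 * (c ^ 2 * m))) ≠ 0 := by
      simpa using Real.exp_pos _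
    have hmarkov := meas_ge_le_lintegral_div hWmeas hpos ENNReal.ofReal_ne_top
    have hbound : μ (D ∩ {ω | (stats g x A t ω).cnt k = m}) ≤
        ENNReal.ofReal (((t + 1 : ℕ) : ℝ) ^ (-(4 + 2 * ε))) := by
      refine (measure_mono hsub).trans (hmarkov.trans ?_)
      have hexp : ((t + 1 : ℕ) : ℝ) ^ (-(4 + 2 * ε)) = (Real.exp (2 * (c ^ 2 * m)))⁻¹ := by
        rw [hc2, ← Real.exp_neg, Real.rpow_def_of_pos hn]
        congr 1; ring
      rw [hexp, ENNReal.ofReal_inv_of_pos (Real.exp_pos _), ← one_div]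
      exact ENNReal.div_le_div_right
        (hA.lintegral_exp_error_le henv hU hU_indep hg hgB lam i k t) _
    exact ENNReal.toReal_le_of_le_ofReal (by positivity) hbound
  calc μ.real D ≤ μ.real (⋃ m ∈ Finset.Icc 1 t, D ∩ {ω | (stats g x A t ω).cnt k = m}) :=
        measureReal_mono hcover (measure_ne_top _ _)
    _ ≤ ∑ m ∈ Finset.Icc 1 t, μ.real (D ∩ {ω | (stats g x A t ω).cnt k = m}) :=
        measureReal_biUnion_finset_le _ _
    _ ≤ ∑ m ∈ Finset.Icc 1 t, ((t + 1 : ℕ) : ℝ) ^ (-(4 + 2 * ε)) := Finset.sum_le_sum hpiece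
    _ = t * ((t + 1 : ℕ) : ℝ) ^ (-(4 + 2 * ε)) := by simp
    _ ≤ ((t + 1 : ℕ) : ℝ) ^ (1 : ℝ) * ((t + 1 : ℕ) : ℝ) ^ (-(4 + 2 * ε)) := by
        gcongr
        rw [Real.rpow_one]; push_cast; linarith
    _ = _ := by rw [← Real.rpow_add hn]; congr 1; ring

/-- Hoeffding's inequality for the number of trials with context `i`. -/
theorem IsEnvironment.measureReal_context_count_lt_le (henv : IsEnvironment μ y x) {i : Fin M}
    (hp : 0 ≤ contextProb μ y i) (t : ℕ) :
    μ.real {ω | (((Finset.range t).filter fun s => y s ω = i).card : ℝ) <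
      contextProb μ y i * t / 2} ≤ Real.exp (-(t * (contextProb μ y i ^ 2 / 2))) := by
  set p := contextProb μ y i with hpdef
  -- The negative indicator turns the lower tail of the count into an upper tail.
  let φ : Fin M × (Fin K → X) → ℝ := fun z => if z.1 = i then -1 else 0
  have hφ : Measurable φ := Measurable.ite (measurable_fst (MeasurableSet.singleton i))
    measurable_const measurable_const
  have hint : ∀ s, ∫ ω, φ (y s ω, x s ω) ∂μ = -p := fun s => by
    have h1 : (fun ω => φ (y s ω, x s ω)) = {ω | y s ω = i}.indicator fun _ => (-1 : ℝ) := by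
      funext ω
      by_cases h : y s ω = i <;> simp [φ, h]
    have h2 : MeasurableSet {ω | y s ω = i} :=
      henv.measurable_context s (MeasurableSet.singleton i)
    rw [h1, integral_indicator_const _ h2,
      henv.measureReal_context s i, smul_eq_mul, mul_neg_one]
  have hsub : ∀ s < t, HasSubgaussianMGF (fun ω => φ (y s ω, x s ω) + p)
      ((‖(0 : ℝ) - -1‖₊ / 2) ^ 2) μ := fun s _ => by
    have h := hasSubgaussianMGF_of_mem_Icc (μ := μ) (a := -1) (b := 0)
      (hφ.comp (henv.measurable_trial s)).aemeasurable
      (ae_of_all _ fun ω => by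
        by_cases h : y s ω = i <;> simp [φ, h])
    simpa [Function.comp_def, hint s] using h
  have hind : iIndepFun (fun s ω => φ (y s ω, x s ω) + p) μ :=
    henv.indep.comp (fun _ z => φ z + p) fun _ => hφ.add_const p
  have h := HasSubgaussianMGF.measure_sum_range_ge_le_of_iIndepFun hind hsub
    (ε := p * t / 2) (by positivity)
  refine (measureReal_mono fun ω hω => ?_).trans (h.trans (Real.exp_le_exp.2 ?_))
  · simp only [Set.mem_ofPred_eq] at hω ⊢
    have h1 : ∑ s ∈ Finset.range t, (φ (y s ω, x s ω) + p) =
        -(((Finset.range t).filter fun s => y s ω = i).card : ℝ) + t * p := by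
      rw [Finset.sum_add_distrib]
      simp [φ, Finset.sum_ite]
    rw [h1]
    linarith
  · rcases t.eq_zero_or_pos with rfl | ht
    · simp
    · have ht' : (0 : ℝ) < t := by exact_mod_cast ht
      refine le_of_eq ?_
      push_cast
      norm_num
      field_simp
      norm_num

end Concentration

/-! ### Pathwise analysis of the policy -/

section Pathwise

variable {y : ℕ → Ω → Fin M} {x : ℕ → Ω → Fin K → X} {g : Fin M → X → ℝ} {A : ℕ → Ω → Fin K}
  {ε : ℝ}

theorem two_mul_bonus_le {R Δ : ℝ} (hΔ : 0 < Δ) {i : Fin M} (hG : 0 ≤ rewardRange g i)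
    (hR : rewardRange g i ≤ R) (hε : 0 ≤ ε) {k : Fin K} {t : ℕ} {ω : Ω}
    (hcnt : 0 < (stats g x A t ω).cnt k)
    (hlog : 4 * (2 + ε) * R ^ 2 / Δ ^ 2 * Real.log (t + 1 : ℕ) ≤ (stats g x A t ω).cnt k) :
    2 * bonus ε g x A i k t ω ≤ Δ := by
  have hlog0 : 0 ≤ Real.log (t + 1 : ℕ) := Real.log_natCast_nonneg _
  have hm : (0 : ℝ) < (stats g x A t ω).cnt k := by exact_mod_cast hcnt
  refine le_of_sq_le_sq ?_ hΔ.le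
  rw [bonus, mul_pow, mul_pow, Real.sq_sqrt (by positivity)]
  rw [div_mul_eq_mul_div, div_le_iff₀ (by positivity)] at hlog
  have hG2 : rewardRange g i ^ 2 ≤ R ^ 2 := pow_le_pow_left₀ hG hR 2
  rw [mul_div_assoc', mul_div_assoc', div_le_iff₀ hm]
  calc 2 ^ 2 * (rewardRange g i ^ 2 * ((2 + ε) * Real.log (t + 1 : ℕ)))
      ≤ 2 ^ 2 * (R ^ 2 * ((2 + ε) * Real.log (t + 1 : ℕ))) := by gcongr
    _ = 4 * (2 + ε) * R ^ 2 * Real.log (t + 1 : ℕ) := by ring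
    _ ≤ _ := by linarith

/-- Pigeonhole: at least `K * b` occurrences of context `i` are shared among `K` arms, and arm `j`
took fewer than `b` of them. -/
theorem exists_card_gt_of_stats_cnt_lt {b : ℝ} {i : Fin M} {j : Fin K} {t : ℕ} {ω : Ω}
    (hN : K * b ≤ ((Finset.range t).filter fun s => y s ω = i).card)
    (hj : ((stats g x A t ω).cnt j : ℝ) < b) :
    ∃ k ≠ j, b < ((Finset.range t).filter fun s => y s ω = i ∧ A s ω = k).card := by
  by_contra! hcon
  have h1 := Finset.card_eq_sum_card_fiberwise (s := (Finset.range t).filter fun s => y s ω = i)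
    (t := Finset.univ) (f := fun s => A s ω) (by simp)
  simp only [Finset.filter_filter] at h1
  rw [h1, Nat.cast_sum] at hN
  have h2 : (((Finset.range t).filter fun s => y s ω = i ∧ A s ω = j).card : ℝ) < b := by
    refine lt_of_le_of_lt ?_ hj
    rw [stats_cnt_eq_card]
    exact_mod_cast Finset.card_le_card fun s hs => by
      simp only [Finset.mem_filter] at hs ⊢
      exact ⟨hs.1, hs.2.2⟩
  have h3 : ∑ k : Fin K, (((Finset.range t).filter fun s => y s ω = i ∧ A s ω = k).card : ℝ) <
      ∑ _k : Fin K, b := by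
    refine Finset.sum_lt_sum (fun k _ => ?_) ⟨j, Finset.mem_univ j, h2⟩
    by_cases hk : k = j
    · subst hk; exact h2.le
    · exact hcon k hk
  rw [Finset.sum_const, Finset.card_univ, Fintype.card_fin, nsmul_eq_mul] at h3
  linarith

variable [MeasurableSpace X] [MeasurableSpace 𝒰] {U : Ω → 𝒰} {θ : Fin M → Fin K → ℝ}
  {h : Fin M → Fin K}

theorem IsDCB.stats_cnt_pos (hA : IsDCB ε g U y x A) {t : ℕ} (ht : K ≤ t) (ω : Ω) (k : Fin K) :
    0 < (stats g x A t ω).cnt k := by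
  rw [stats_cnt_eq_card, Finset.card_pos]
  exact ⟨k, by simp [k.2.trans_le ht, hA.init k k.2 ω]⟩

theorem IsDCB.stats_cnt_eq_zero_of_init (hA : IsDCB ε g U y x A) {t : ℕ} (ht : t < K) (ω : Ω) :
    (stats g x A t ω).cnt (A t ω) = 0 := by
  rw [stats_cnt_eq_card, Finset.card_eq_zero, Finset.filter_eq_empty_iff]
  intro s hs heq
  rw [Finset.mem_range] at hs
  rw [hA.init t ht, hA.init s (hs.trans ht), Fin.mk.injEq] at heq
  exact hs.ne heq

/-- A suboptimal arm with a small confidence radius is only pulled when a confidence bound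
fails. -/
theorem IsDCB.mem_deviationEvent (hA : IsDCB ε g U y x A) {t : ℕ} (ht : K ≤ t) {ω : Ω}
    (hb : 2 * bonus ε g x A (y t ω) (A t ω) t ω ≤ θ (y t ω) (h (y t ω)) - θ (y t ω) (A t ω)) :
    ω ∈ deviationEvent ε g x A θ 1 (y t ω) (A t ω) t ∨
      ω ∈ deviationEvent ε g x A θ (-1) (y t ω) (h (y t ω)) t := by
  by_contra! hcon
  obtain ⟨h1, h2⟩ := hcon
  simp only [deviationEvent, Set.mem_ofPred_eq, hA.stats_cnt_pos ht, true_and, not_le] at h1 h2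
  have h3 : (stats g x A t ω).est (y t ω) (h (y t ω)) + bonus ε g x A (y t ω) (h (y t ω)) t ω ≤
      (stats g x A t ω).est (y t ω) (A t ω) + bonus ε g x A (y t ω) (A t ω) t ω :=
    hA.argmax t ht ω (h (y t ω))
  -- If both bounds held, the index of the pulled arm would be below its mean plus two radii, hence
  -- below the optimal mean, hence below the index of the optimal arm.
  linarith

/-- If arm `k` was pulled more than `b` times for context `i`, then it was pulled for this context
in a late trial, when it had already been pulled more than `b - 1` times. -/
theorem IsDCB.exists_late_pull (hA : IsDCB ε g U y x A) {b : ℝ} (hb : 1 ≤ b) {i : Fin M}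
    {k : Fin K} {t : ℕ} {ω : Ω}
    (hcard : b < ((Finset.range t).filter fun s => y s ω = i ∧ A s ω = k).card) :
    ∃ s < t, y s ω = i ∧ A s ω = k ∧ K ≤ s ∧ b < (s + 1 : ℕ) ∧
      b - 1 < (stats g x A s ω).cnt k := by
  set F := (Finset.range t).filter fun s => y s ω = i ∧ A s ω = k with hF
  have hne : F.Nonempty := by
    rw [← Finset.card_pos]
    exact_mod_cast (zero_lt_one.trans_le hb).trans hcard
  -- The last pull in `F` is preceded by all the others, so at its time the count is at least
  -- `F.card - 1`.
  obtain ⟨s, hs, hmax⟩ := F.exists_max_image id hne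
  have hs' := hs
  simp only [hF, Finset.mem_filter, Finset.mem_range] at hs'
  obtain ⟨hst, hys, hAs⟩ := hs'
  have hle : F.card ≤ (stats g x A s ω).cnt k + 1 := by
    rw [stats_cnt_eq_card]
    refine (Finset.card_le_card fun r hr => ?_).trans (Finset.card_insert_le s _)
    have hrs : r ≤ s := hmax r hr
    simp only [hF, Finset.mem_filter, Finset.mem_range] at hr
    rcases hrs.eq_or_lt with rfl | hlt
    · simp
    · simp [hlt, hr.2.2]
  have hle' : (F.card : ℝ) ≤ (stats g x A s ω).cnt k + 1 := by exact_mod_cast hle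
  have hcnt : ((stats g x A s ω).cnt k : ℝ) ≤ s := by exact_mod_cast stats_cnt_le s ω k
  refine ⟨s, hst, hys, hAs, ?_, by push_cast; linarith, by linarith⟩
  -- A forced initial pull has count 0 before it, so `F` would have at most one element, against `1
  -- ≤ b < F.card`.
  by_contra! hsK
  have h0 := hA.stats_cnt_eq_zero_of_init hsK ω
  rw [hAs] at h0
  rw [h0, Nat.cast_zero] at hle'
  linarith

/-- If an optimal arm was pulled rarely, then either its contexts were rare or a confidence bound
failed in a late trial. -/
theorem IsDCB.stats_cnt_lt_subset (hA : IsDCB ε g U y x A) (hε : 0 ≤ ε) {R Δ : ℝ} (hΔ : 0 < Δ)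
    {i : Fin M} (hG : 0 ≤ rewardRange g i) (hR : rewardRange g i ≤ R)
    (hgap : ∀ k ≠ h i, Δ ≤ θ i (h i) - θ i k) {b : ℝ} {t : ℕ}
    (hb : 1 ≤ b - 4 * (2 + ε) * R ^ 2 / Δ ^ 2 * Real.log t) :
    {ω | ((stats g x A t ω).cnt (h i) : ℝ) < b} ⊆
      {ω | (((Finset.range t).filter fun s => y s ω = i).card : ℝ) < K * b} ∪
        ⋃ s ∈ (Finset.range t).filter (fun s => b < (s + 1 : ℕ)), ⋃ k : Fin K,
          {ω | y s ω = i} ∩ deviationEvent ε g x A θ (if k = h i then -1 else 1) i k s := by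
  intro ω hω
  by_cases hN : (((Finset.range t).filter fun s => y s ω = i).card : ℝ) < K * b
  · exact Or.inl hN
  right
  obtain ⟨k, hk, hcard⟩ := exists_card_gt_of_stats_cnt_lt (not_lt.1 hN) hω
  have hc : 0 ≤ 4 * (2 + ε) * R ^ 2 / Δ ^ 2 := by positivity
  have hb1 : 1 ≤ b := by
    have := mul_nonneg hc (Real.log_natCast_nonneg t)
    linarith
  obtain ⟨s, hst, hys, hAs, hKs, hbs, hcnt⟩ := hA.exists_late_pull hb1 hcard
  have hlog : Real.log (s + 1 : ℕ) ≤ Real.log t :=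
    Real.log_le_log (by positivity) (by exact_mod_cast hst)
  have hbonus : 2 * bonus ε g x A i k s ω ≤ Δ := by
    refine two_mul_bonus_le hΔ hG hR hε (hA.stats_cnt_pos hKs ω k) ?_
    have := mul_le_mul_of_nonneg_left hlog hc
    linarith
  have hdev := hA.mem_deviationEvent (θ := θ) (h := h) hKs (ω := ω)
    (by rw [hys, hAs]; exact hbonus.trans (hgap k hk))
  rw [hys, hAs] at hdev
  simp only [Set.mem_iUnion]
  refine ⟨s, by simpa using ⟨hst, by simpa using hbs⟩, ?_⟩
  -- The suboptimal arm is overestimated or the optimal arm is underestimated. The arm thus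
  -- determines the sign, and each trial contributes `K` events instead of `2 * K`.
  rcases hdev with hdev | hdev
  · exact ⟨k, hys, by rwa [if_neg hk]⟩
  · exact ⟨h i, hys, by rwa [if_pos rfl]⟩

/-- Suboptimal pulls of an arm that was pulled often require the failure of a confidence bound. -/
theorem IsDCB.suboptimal_pull_subset (hA : IsDCB ε g U y x A) (hε : 0 ≤ ε) {R Δ : ℝ}
    (hΔ : 0 < Δ) (hG : ∀ i, 0 ≤ rewardRange g i) (hR : ∀ i, rewardRange g i ≤ R)
    (hgap : ∀ i, ∀ k ≠ h i, Δ ≤ θ i (h i) - θ i k) {b : ℝ} {t : ℕ} (ht : K ≤ t)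
    (hb : 4 * (2 + ε) * R ^ 2 / Δ ^ 2 * Real.log (t + 1 : ℕ) ≤ b) (j : Fin K) :
    {ω | A t ω = j ∧ h (y t ω) ≠ j} ⊆ {ω | ((stats g x A t ω).cnt j : ℝ) < b} ∪
      ⋃ i ∈ Finset.univ.filter (fun i => h i ≠ j),
        (({ω | y t ω = i} ∩ deviationEvent ε g x A θ 1 i j t) ∪
          ({ω | y t ω = i} ∩ deviationEvent ε g x A θ (-1) i (h i) t)) := by
  rintro ω ⟨rfl, hne⟩
  by_cases hcnt : ((stats g x A t ω).cnt (A t ω) : ℝ) < b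
  · exact Or.inl hcnt
  right
  have hbonus := two_mul_bonus_le hΔ (hG (y t ω)) (hR (y t ω)) hε (hA.stats_cnt_pos ht ω (A t ω))
    (hb.trans (not_lt.1 hcnt))
  simp only [Set.mem_iUnion]
  refine ⟨y t ω, by simpa using hne, ?_⟩
  rcases hA.mem_deviationEvent (θ := θ) (h := h) ht
    (hbonus.trans (hgap _ _ hne.symm)) with hdev | hdev
  · exact Or.inl ⟨rfl, hdev⟩
  · exact Or.inr ⟨rfl, hdev⟩

end Pathwise

/-! ### Probability bounds -/

section Bounds

variable [MeasurableSpace X] [MeasurableSpace 𝒰] {U : Ω → 𝒰} {y : ℕ → Ω → Fin M}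
  {x : ℕ → Ω → Fin K → X} {g : Fin M → X → ℝ} {A : ℕ → Ω → Fin K} {ε : ℝ} {h : Fin M → Fin K}
  [mΩ : MeasurableSpace Ω] {μ : Measure Ω} [IsProbabilityMeasure μ]

theorem IsDCB.measureReal_context_inter_deviationEvent_le (hA : IsDCB ε g U y x A)
    (henv : IsEnvironment μ y x) (hU : Measurable U)
    (hU_indep : IndepFun U (fun ω t => (y t ω, x t ω)) μ)
    (hg : ∀ i, Measurable (g i)) (hgB : ∃ B : ℝ, ∀ i s, |g i s| ≤ B) (hε : 0 ≤ ε) {i : Fin M}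
    (hG : 0 < rewardRange g i) {σ : ℝ} (hσ : σ ^ 2 = 1) (k : Fin K) (t : ℕ) :
    μ.real ({ω | y t ω = i} ∩ deviationEvent ε g x A (meanReward μ g x) σ i k t) ≤
      contextProb μ y i * ((t + 1 : ℕ) : ℝ) ^ (-(3 + 2 * ε)) := by
  rw [henv.measureReal_context_inter hU hU_indep t i (hA.measurableSet_deviationEvent hg _ _ _ _ _)]
  exact mul_le_mul_of_nonneg_left
    (hA.measureReal_deviationEvent_le henv hU hU_indep hg hgB hε hG hσ k t) measureReal_nonneg

/-- The threshold `b` is a `K`-th part of half the expected number of occurrences of context `i`. At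
most `t * K` failure events remain, each in a trial numbered above `b` and so of probability at most
`p * b ^ (-(3 + 2ε))`; one power of `p` and one of `t` cancel. -/
theorem IsDCB.measureReal_stats_cnt_lt_le (hA : IsDCB ε g U y x A)
    (henv : IsEnvironment μ y x) (hU : Measurable U)
    (hU_indep : IndepFun U (fun ω t => (y t ω, x t ω)) μ)
    (hg : ∀ i, Measurable (g i)) (hgB : ∃ B : ℝ, ∀ i s, |g i s| ≤ B) (hε : 0 ≤ ε) {R Δ : ℝ}
    (hΔ : 0 < Δ) {i : Fin M} (hG : 0 < rewardRange g i) (hR : rewardRange g i ≤ R)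
    (hgap : ∀ k ≠ h i, Δ ≤ meanReward μ g x i (h i) - meanReward μ g x i k)
    (hp : 0 < contextProb μ y i) {t : ℕ} (ht : 0 < t)
    (hb : 1 ≤ contextProb μ y i * t / (2 * K) - 4 * (2 + ε) * R ^ 2 / Δ ^ 2 * Real.log t) :
    μ.real {ω | ((stats g x A t ω).cnt (h i) : ℝ) < contextProb μ y i * t / (2 * K)} ≤
      Real.exp (-(t * (contextProb μ y i ^ 2 / 2))) +
        2 ^ (3 + 2 * ε) * (K : ℝ) ^ (4 + 2 * ε) * (t : ℝ) ^ (-(2 + 2 * ε)) *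
          (1 / contextProb μ y i ^ (2 + 2 * ε)) := by
  set p := contextProb μ y i with hpdef
  have hK : (0 : ℝ) < K := by exact_mod_cast (h i).pos
  have ht' : (0 : ℝ) < t := by exact_mod_cast ht
  set b := p * t / (2 * K) with hbdef
  have hb0 : 0 < b := by positivity
  have hKb : K * b = p * t / 2 := by rw [hbdef]; field_simp
  refine (measureReal_mono (hA.stats_cnt_lt_subset hε hΔ hG.le hR hgap hb)
    (measure_ne_top _ _)).trans ((measureReal_union_le _ _).trans (add_le_add ?_ ?_))
  · rw [hKb]
    exact henv.measureReal_context_count_lt_le hp.le t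
  have hterm : ∀ s ∈ (Finset.range t).filter (fun s => b < (s + 1 : ℕ)), ∀ k : Fin K,
      μ.real ({ω | y s ω = i} ∩
        deviationEvent ε g x A (meanReward μ g x) (if k = h i then -1 else 1) i k s) ≤
        p * b ^ (-(3 + 2 * ε)) := fun s hs k => by
    refine (hA.measureReal_context_inter_deviationEvent_le henv hU hU_indep hg hgB hε hG
      (by split_ifs <;> norm_num) k s).trans (mul_le_mul_of_nonneg_left ?_ hp.le)
    exact Real.rpow_le_rpow_of_nonpos hb0 (Finset.mem_filter.1 hs).2.le (by linarith)
  calc _ ≤ ∑ s ∈ (Finset.range t).filter (fun s => b < (s + 1 : ℕ)), ∑ k : Fin K,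
        μ.real ({ω | y s ω = i} ∩
          deviationEvent ε g x A (meanReward μ g x) (if k = h i then -1 else 1) i k s) :=
        (measureReal_biUnion_finset_le _ _).trans
          (Finset.sum_le_sum fun s _ => measureReal_iUnion_fintype_le _)
    _ ≤ ∑ s ∈ (Finset.range t).filter (fun s => b < (s + 1 : ℕ)), ∑ _k : Fin K,
        p * b ^ (-(3 + 2 * ε)) :=
        Finset.sum_le_sum fun s hs => Finset.sum_le_sum fun k _ => hterm s hs k
    _ ≤ ∑ s ∈ Finset.range t, ∑ _k : Fin K, p * b ^ (-(3 + 2 * ε)) :=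
        Finset.sum_le_sum_of_subset_of_nonneg (Finset.filter_subset _ _)
          fun _ _ _ => Finset.sum_nonneg fun _ _ => by positivity
    _ = t * K * p * b ^ (-(3 + 2 * ε)) := by
        simp only [Finset.sum_const, Finset.card_univ, Finset.card_range, Fintype.card_fin,
          nsmul_eq_mul]
        ring
    _ = _ := by
        have h1 : (K : ℝ) ^ (4 + 2 * ε) = K ^ (3 + 2 * ε) * K := by
          rw [show (4 : ℝ) + 2 * ε = 3 + 2 * ε + 1 by ring, Real.rpow_add_one hK.ne']
        have h2 : ∀ z : ℝ, 0 < z → z ^ (3 + 2 * ε) = z ^ (2 + 2 * ε) * z := fun z hz => by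
          rw [show (3 : ℝ) + 2 * ε = 2 + 2 * ε + 1 by ring, Real.rpow_add_one hz.ne']
        rw [hbdef, Real.rpow_neg (by positivity), Real.rpow_neg ht'.le,
          Real.div_rpow (by positivity) (by positivity), Real.mul_rpow hp.le ht'.le,
          Real.mul_rpow (by norm_num) hK.le, h1, h2 p hp, h2 t ht']
        have hz1 : (0 : ℝ) < p ^ (2 + 2 * ε) := by positivity
        have hz2 : (0 : ℝ) < (t : ℝ) ^ (2 + 2 * ε) := by positivity
        field_simp

theorem IsDCB.measureReal_suboptimal_pull_le (hA : IsDCB ε g U y x A)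
    (henv : IsEnvironment μ y x) (hU : Measurable U)
    (hU_indep : IndepFun U (fun ω t => (y t ω, x t ω)) μ)
    (hg : ∀ i, Measurable (g i)) (hgB : ∃ B : ℝ, ∀ i s, |g i s| ≤ B) (hε : 0 ≤ ε) {R Δ : ℝ}
    (hΔ : 0 < Δ) (hG : ∀ i, 0 < rewardRange g i) (hR : ∀ i, rewardRange g i ≤ R)
    (hgap : ∀ i, ∀ k ≠ h i, Δ ≤ meanReward μ g x i (h i) - meanReward μ g x i k)
    {b : ℝ} {t : ℕ} (ht : K ≤ t)
    (hb : 4 * (2 + ε) * R ^ 2 / Δ ^ 2 * Real.log (t + 1 : ℕ) ≤ b) (j : Fin K) :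
    μ.real {ω | A t ω = j ∧ h (y t ω) ≠ j} ≤
      μ.real {ω | ((stats g x A t ω).cnt j : ℝ) < b} +
        2 * (∑ i with h i ≠ j, contextProb μ y i) * ((t + 1 : ℕ) : ℝ) ^ (-(3 + 2 * ε)) := by
  refine (measureReal_mono (hA.suboptimal_pull_subset hε hΔ (fun i => (hG i).le) hR hgap ht hb j)
    (measure_ne_top _ _)).trans ((measureReal_union_le _ _).trans (add_le_add le_rfl ?_))
  rw [Finset.mul_sum, Finset.sum_mul]
  refine (measureReal_biUnion_finset_le _ _).trans (Finset.sum_le_sum fun i _ => ?_)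
  refine (measureReal_union_le _ _).trans ?_
  have h1 := hA.measureReal_context_inter_deviationEvent_le henv hU hU_indep hg hgB hε (hG i)
    (σ := 1) (by norm_num) j t
  have h2 := hA.measureReal_context_inter_deviationEvent_le henv hU hU_indep hg hgB hε (hG i)
    (σ := -1) (by norm_num) (h i) t
  linarith

theorem integral_nonOptimalPulls (hA : ∀ t, Measurable (A t)) (hy : ∀ t, Measurable (y t))
    (j : Fin K) (n : ℕ) :
    ∫ ω, (nonOptimalPulls h y A j n ω : ℝ) ∂μ =
      ∑ t ∈ Finset.range n, μ.real {ω | A t ω = j ∧ h (y t ω) ≠ j} := by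
  have hmeas : ∀ t, MeasurableSet {ω | A t ω = j ∧ h (y t ω) ≠ j} := fun t =>
    (hA t (MeasurableSet.singleton j)).inter
      (hy t (MeasurableSet.of_discrete (s := {i | h i ≠ j})))
  have hsum : ∀ ω, (nonOptimalPulls h y A j n ω : ℝ) =
      ∑ t ∈ Finset.range n, {ω | A t ω = j ∧ h (y t ω) ≠ j}.indicator (fun _ => (1 : ℝ)) ω :=
    fun ω => by
      rw [nonOptimalPulls, Finset.card_filter, Nat.cast_sum]
      refine Finset.sum_congr rfl fun t _ => ?_
      simp [Set.indicator_apply]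
  simp_rw [hsum]
  rw [integral_finsetSum _ fun t _ => (integrable_const 1).indicator (hmeas t)]
  refine Finset.sum_congr rfl fun t _ => ?_
  rw [integral_indicator_const _ (hmeas t), smul_eq_mul, mul_one]

end Bounds

/-! ### Positivity of the model constants -/

/-- A reward of range 0 is constant, which would make all means equal. Positivity is needed because
the exponential parameter divides by the range. -/
theorem rewardRange_pos_of_meanReward_ne [MeasurableSpace Ω] {μ : Measure Ω}
    {x : ℕ → Ω → Fin K → X} {g : Fin M → X → ℝ} (hgB : ∃ B : ℝ, ∀ i s, |g i s| ≤ B) {i : Fin M}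
    {j k : Fin K} (hne : meanReward μ g x i j ≠ meanReward μ g x i k) :
    0 < rewardRange g i := by
  obtain ⟨B, hB⟩ := hgB
  have h1 : ∀ s, ⨅ s, g i s ≤ g i s :=
    ciInf_le ⟨-B, by rintro _ ⟨s, rfl⟩; exact (abs_le.1 (hB i s)).1⟩
  have h2 : ∀ s, g i s ≤ ⨆ s, g i s :=
    le_ciSup (f := g i) ⟨B, by rintro _ ⟨s, rfl⟩; exact (abs_le.1 (hB i s)).2⟩
  by_contra! hle
  rw [rewardRange] at hle
  refine hne (integral_congr_ae (ae_of_all _ fun ω => ?_))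
  have := h1 (x 0 ω j)
  have := h2 (x 0 ω j)
  have := h1 (x 0 ω k)
  have := h2 (x 0 ω k)
  show g i (x 0 ω j) = g i (x 0 ω k)
  linarith

theorem minProb_le {p : Fin M → ℝ} (i : Fin M) : minProb p ≤ p i :=
  ciInf_le (Set.finite_range p).bddBelow i

theorem minProb_pos [Nonempty (Fin M)] {p : Fin M → ℝ} (hp : ∀ i, 0 < p i) : 0 < minProb p := by
  obtain ⟨i, hi⟩ := exists_eq_ciInf_of_finite (f := p)
  rw [minProb, ← hi]
  exact hp i

theorem minGap_le {θ : Fin M → Fin K → ℝ} {h : Fin M → Fin K} {i : Fin M} {k : Fin K}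
    (hk : k ≠ h i) : minGap θ h ≤ θ i (h i) - θ i k :=
  ciInf_le (f := fun q : {q : Fin M × Fin K // h q.1 ≠ q.2} =>
    θ q.1.1 (h q.1.1) - θ q.1.1 q.1.2) (Set.finite_range _).bddBelow ⟨(i, k), hk.symm⟩

theorem IsBayesOptimal.minGap_pos {θ : Fin M → Fin K → ℝ} {h : Fin M → Fin K}
    (hh : IsBayesOptimal θ h) {i : Fin M} {k : Fin K} (hk : k ≠ h i) : 0 < minGap θ h := by
  have : Nonempty {q : Fin M × Fin K // h q.1 ≠ q.2} := ⟨⟨(i, k), hk.symm⟩⟩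
  obtain ⟨q, hq⟩ := exists_eq_ciInf_of_finite
    (f := fun q : {q : Fin M × Fin K // h q.1 ≠ q.2} => θ q.1.1 (h q.1.1) - θ q.1.1 q.1.2)
  rw [minGap, ← hq]
  exact sub_pos.2 (hh _ _ q.2.symm)

theorem sum_filter_le_sum_succ {f : ℕ → ℝ} (hf : ∀ t, 0 ≤ f t) {m : ℕ} (hm : 0 < m) (n : ℕ) :
    ∑ t ∈ (Finset.range n).filter (fun t => m ≤ t), f t ≤ ∑ t ∈ Finset.range n, f (t + 1) := by
  rw [← Finset.sum_image (s := Finset.range n) (g := fun t => t + 1) (f := f)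
    (fun a _ b _ hab => by simpa using hab)]
  refine Finset.sum_le_sum_of_subset_of_nonneg (fun t ht => ?_) fun t _ _ => hf t
  simp only [Finset.mem_filter, Finset.mem_range] at ht
  exact Finset.mem_image.2 ⟨t - 1, Finset.mem_range.2 (by omega), by omega⟩

end ContextualBandit

end

/-! ### The regret bound -/

theorem theorem2 {M K : ℕ} {Ω X 𝒰 : Type*}
    [MeasurableSpace Ω] [MeasurableSpace X] [MeasurableSpace 𝒰]
    (μ : Measure Ω) [IsProbabilityMeasure μ]
    -- the environment: contexts, arm states, bounded reward function
    (y : ℕ → Ω → Fin M) (x : ℕ → Ω → Fin K → X)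
    (henv : ContextualBandit.IsEnvironment μ y x)
    (g : Fin M → X → ℝ) (hg : ∀ i, Measurable (g i)) (hgB : ∃ B : ℝ, ∀ i s, |g i s| ≤ B)
    (p : Fin M → ℝ) (hp : p = ContextualBandit.contextProb μ y) (hp_pos : ∀ i, 0 < p i)
    (θ : Fin M → Fin K → ℝ) (hθ : θ = ContextualBandit.meanReward μ g x)
    (h : Fin M → Fin K) (hh : ContextualBandit.IsBayesOptimal θ h)
    -- a common bound for the reward ranges (`R = 1` for normalized rewards)
    (R : ℝ) (hR : ∀ i, ContextualBandit.rewardRange g i ≤ R)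
    -- the policy DCB(ε), with its internal randomization `U` (used for ties only)
    (ε : ℝ) (hε : 0 < ε)
    (U : Ω → 𝒰) (hU : Measurable U) (hU_indep : IndepFun U (fun ω t => (y t ω, x t ω)) μ)
    (A : ℕ → Ω → Fin K) (hA : ContextualBandit.IsDCB ε g U y x A) :
    ∃ n₀ : ℕ,
      IsLeast {n : ℕ |
        ⌊ContextualBandit.minProb p * n / (2 * K)⌋ >
          ⌈4 * (2 + ε) * R ^ 2 * Real.log n / ContextualBandit.minGap θ h ^ 2⌉} n₀ ∧
      ∀ j : Fin K, (∃ i, h i = j) → ∀ n : ℕ,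
        ∫ ω, (ContextualBandit.nonOptimalPulls h y A j n ω : ℝ) ∂μ ≤
          n₀ + (∑ i with h i = j, 2 / p i ^ 2) +
            (2 : ℝ) ^ (3 + 2 * ε) * (K : ℝ) ^ (4 + 2 * ε) *
              (∑' k : ℕ, 1 / ((k : ℝ) + 1) ^ (1 + 2 * ε)) *
              (∑ i with h i = j, 1 / p i ^ (2 + 2 * ε)) +
            Real.pi ^ 2 / 3 * ∑ i with h i ≠ j, p i := by
  classical
  have hΩ : Nonempty Ω := nonempty_of_isProbabilityMeasure μ
  obtain ⟨ω₀⟩ := hΩ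
  have hM : Nonempty (Fin M) := ⟨y 0 ω₀⟩
  have hKpos : 0 < K := (h (y 0 ω₀)).pos
  have hK : (1 : ℝ) ≤ K := by exact_mod_cast hKpos
  subst hp hθ
  set p := ContextualBandit.contextProb μ y with hp
  set θ := ContextualBandit.meanReward μ g x with hθ
  set Δ := ContextualBandit.minGap θ h with hΔ
  set a := ContextualBandit.minProb p / (2 * K) with ha
  set c := 4 * (2 + ε) * R ^ 2 / Δ ^ 2 with hc
  have hc0 : 0 ≤ c := by positivity
  have hpo : 0 < ContextualBandit.minProb p := ContextualBandit.minProb_pos hp_pos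
  have hpo1 : ContextualBandit.minProb p ≤ 1 :=
    (ContextualBandit.minProb_le (y 0 ω₀)).trans measureReal_le_one
  have ha0 : 0 < a := by positivity
  have ha1 : a * K ≤ 1 / 2 := by
    rw [ha]; field_simp; linarith
  have hset : ∀ n : ℕ, ⌊ContextualBandit.minProb p * n / (2 * K)⌋ >
      ⌈4 * (2 + ε) * R ^ 2 * Real.log n / Δ ^ 2⌉ ↔ ⌈c * Real.log n⌉ < ⌊a * n⌋ := fun n => by
    rw [gt_iff_lt, ha, hc, div_mul_eq_mul_div, div_mul_eq_mul_div]
  have hex := ContextualBandit.exists_ceil_log_lt_floor ha0 c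
  refine ⟨Nat.find hex, ⟨(hset _).2 (Nat.find_spec hex),
    fun n hn => Nat.find_min' hex ((hset n).1 hn)⟩, ?_⟩
  have hn₀ := ContextualBandit.one_le_sub_of_ceil_lt_floor (Nat.find_spec hex)
  set n₀ := Nat.find hex
  have hlog₀ : 0 ≤ c * Real.log n₀ := mul_nonneg hc0 (Real.log_natCast_nonneg _)
  -- Since `a * n₀ ≥ 1` while `a * K ≤ 1 / 2`, the initial phase is over before `n₀`.
  have hKn₀ : K < n₀ := by
    by_contra! hle
    have hle' : (n₀ : ℝ) ≤ K := by exact_mod_cast hle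
    have := mul_le_mul_of_nonneg_left hle' ha0.le
    linarith
  have hn₀1 : 1 < n₀ := by omega
  have ha1' : a ≤ 1 := (le_mul_of_one_le_right ha0.le hK).trans (ha1.trans (by norm_num))
  have hlin : ∀ t, n₀ ≤ t → 1 ≤ a * t - c * Real.log t := fun t ht =>
    ContextualBandit.one_le_linear_sub_log_of_le ha1' hc0 hn₀1 hn₀ ht
  rintro j ⟨i, rfl⟩ n
  set P := ∑ i' with h i' ≠ h i, p i' with hP
  have hP0 : 0 ≤ P := Finset.sum_nonneg fun i' _ => (hp_pos i').le
  set cε := ∑' k : ℕ, 1 / ((k : ℝ) + 1) ^ (1 + 2 * ε) with hcε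
  have hcε0 : 0 ≤ cε := tsum_nonneg fun k => by positivity
  have hcoef : (0 : ℝ) ≤ 2 ^ (3 + 2 * ε) * (K : ℝ) ^ (4 + 2 * ε) := by positivity
  have hmem : i ∈ Finset.univ.filter fun i' => h i' = h i := by simp
  have hs1 : 2 / p i ^ 2 ≤ ∑ i' with h i' = h i, 2 / p i' ^ 2 :=
    Finset.single_le_sum (f := fun i' => 2 / p i' ^ 2) (fun i' _ => by positivity) hmem
  have hs2 : 1 / p i ^ (2 + 2 * ε) ≤ ∑ i' with h i' = h i, 1 / p i' ^ (2 + 2 * ε) :=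
    Finset.single_le_sum (f := fun i' => 1 / p i' ^ (2 + 2 * ε))
      (fun i' _ => by have := hp_pos i'; positivity) hmem
  have hgoal : ∫ ω, (ContextualBandit.nonOptimalPulls h y A (h i) n ω : ℝ) ∂μ ≤
      n₀ + 2 / p i ^ 2 + 2 ^ (3 + 2 * ε) * (K : ℝ) ^ (4 + 2 * ε) * cε *
        (1 / p i ^ (2 + 2 * ε)) + Real.pi ^ 2 / 3 * P := by
    have hpi := hp_pos i
    -- If one arm is optimal for all contexts, it has no nonoptimal pulls. This covers `K = 1`,
    -- where the infimum defining `Δ` is over the empty set, hence 0, and division by it gives `c =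
    -- 0`. Otherwise two distinct arms exist, so `Δ` and all ranges are positive.
    by_cases htriv : ∀ i', h i' = h i
    · have h0 : ∀ ω, (ContextualBandit.nonOptimalPulls h y A (h i) n ω : ℝ) = 0 := fun ω => by
        simp [ContextualBandit.nonOptimalPulls, htriv]
      simp_rw [h0]
      rw [integral_zero]
      positivity
    push Not at htriv
    obtain ⟨i₁, hi₁⟩ := htriv
    have hΔ0 : 0 < Δ := hh.minGap_pos (i := i₁) (k := h i) hi₁.symm
    have hG : ∀ i', 0 < ContextualBandit.rewardRange g i' := fun i' => by
      have hex : ∃ k, k ≠ h i' := by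
        by_cases hi' : h i' = h i
        · exact ⟨h i₁, by rwa [hi']⟩
        · exact ⟨h i, Ne.symm hi'⟩
      obtain ⟨k, hk⟩ := hex
      exact ContextualBandit.rewardRange_pos_of_meanReward_ne hgB (hh i' k hk).ne
    have hgap : ∀ i', ∀ k ≠ h i', Δ ≤ θ i' (h i') - θ i' k := fun i' k hk =>
      ContextualBandit.minGap_le hk
    rw [ContextualBandit.integral_nonOptimalPulls (hA.measurable henv hU)
      henv.measurable_context]
    let f₁ : ℕ → ℝ := fun t => Real.exp (-(t * (p i ^ 2 / 2)))
    let f₂ : ℕ → ℝ := fun t => (t : ℝ) ^ (-(2 + 2 * ε))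
    let f₃ : ℕ → ℝ := fun t => ((t + 1 : ℕ) : ℝ) ^ (-(3 + 2 * ε))
    have hbound : ∀ t, n₀ ≤ t → μ.real {ω | A t ω = h i ∧ h (y t ω) ≠ h i} ≤
        f₁ t + 2 ^ (3 + 2 * ε) * (K : ℝ) ^ (4 + 2 * ε) * (1 / p i ^ (2 + 2 * ε)) * f₂ t +
          2 * P * f₃ t := fun t ht => by
      have hle : a * t ≤ p i * t / (2 * K) := by
        rw [ha, div_mul_eq_mul_div]
        have := ContextualBandit.minProb_le (p := p) i
        gcongr
      have hb₁ : 1 ≤ p i * t / (2 * K) - c * Real.log t := by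
        have := hlin t ht
        linarith
      -- The index uses `log (t + 1)` but the threshold uses `t`: the margin 1 at `t + 1` absorbs
      -- the extra `a ≤ 1`.
      have hb₂ : c * Real.log (t + 1 : ℕ) ≤ p i * t / (2 * K) := by
        have := hlin (t + 1) (by omega)
        push_cast at this ⊢
        linarith
      have h₁ := hA.measureReal_suboptimal_pull_le henv hU hU_indep hg hgB hε.le hΔ0 hG hR hgap
        (by omega : K ≤ t) hb₂ (h i)
      have h₂ := hA.measureReal_stats_cnt_lt_le henv hU hU_indep hg hgB hε.le hΔ0 (hG i) (hR i)
        (hgap i) hpi (by omega : 0 < t) hb₁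
      refine h₁.trans (add_le_add (h₂.trans (le_of_eq ?_)) le_rfl)
      simp only [f₁, f₂]
      ring
    have hS₁ : ∑ t ∈ (Finset.range n).filter (fun t => n₀ ≤ t), f₁ t ≤ 2 / p i ^ 2 := by
      refine (ContextualBandit.sum_filter_le_sum_succ (fun t => (Real.exp_pos _).le)
        (by omega : 0 < n₀) n).trans ?_
      refine (ContextualBandit.sum_exp_neg_succ_mul_le (by positivity) n).trans (le_of_eq ?_)
      rw [one_div_div]
    -- The terms decay with exponent `2 + 2ε`, faster than the exponent `1 + 2ε` in `cε` requires.
    have hS₂ : ∑ t ∈ (Finset.range n).filter (fun t => n₀ ≤ t), f₂ t ≤ cε :=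
      (ContextualBandit.sum_filter_le_sum_succ (fun t => by positivity)
        (by omega : 0 < n₀) n).trans
        (ContextualBandit.sum_succ_rpow_neg_le_tsum (by linarith) (by linarith) _)
    have hS₃ : ∑ t ∈ (Finset.range n).filter (fun t => n₀ ≤ t), f₃ t ≤ Real.pi ^ 2 / 6 :=
      ContextualBandit.sum_succ_rpow_neg_le_zeta_two (by linarith) _
    -- Time starts at 0, so `t < n₀` describes at most `n₀` trials, each of probability at most 1.
    have hearly : ∑ t ∈ (Finset.range n).filter (fun t => ¬ n₀ ≤ t),
        μ.real {ω | A t ω = h i ∧ h (y t ω) ≠ h i} ≤ n₀ := by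
      refine (Finset.sum_le_sum fun t _ => measureReal_le_one).trans ?_
      rw [Finset.sum_const, nsmul_eq_mul, mul_one]
      have : ((Finset.range n).filter fun t => ¬ n₀ ≤ t).card ≤ (Finset.range n₀).card :=
        Finset.card_le_card fun t ht => by
          simp only [Finset.mem_filter, not_le] at ht
          exact Finset.mem_range.2 ht.2
      rw [Finset.card_range] at this
      exact_mod_cast this
    have hlate := Finset.sum_le_sum (s := (Finset.range n).filter fun t => n₀ ≤ t)
      fun t ht => hbound t (Finset.mem_filter.1 ht).2
    rw [Finset.sum_add_distrib, Finset.sum_add_distrib, ← Finset.mul_sum, ← Finset.mul_sum]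
      at hlate
    have hT₂ := mul_le_mul_of_nonneg_left hS₂
      (show 0 ≤ 2 ^ (3 + 2 * ε) * (K : ℝ) ^ (4 + 2 * ε) * (1 / p i ^ (2 + 2 * ε)) by positivity)
    have hT₃ := mul_le_mul_of_nonneg_left hS₃ (show 0 ≤ 2 * P by positivity)
    rw [← Finset.sum_filter_add_sum_filter_not _ (fun t => n₀ ≤ t)]
    linarith
  have hs2' := mul_le_mul_of_nonneg_left hs2 (mul_nonneg hcoef hcε0)
  linarith
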